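/- Let $G$ be a connected, vertex-transitive, $(q+1)$-regular simple graph ($q\ge 0$; finite, or more generally possibly infinite), let $D_G$ be its symmetric digraph, whose arcs are the ordered pairs $(u,v)$ with $uv\in E(G)$, and fix a vertex $x_0$ of $G$. Write $o(e)=u$, $t(e)=v$ and $e^{-1}=(v,u)$ for an arc $e=(u,v)$. An $x_0$-cycle of length $k\ge 1$ in $G$ is a sequence of arcs $C=(e_1,\dots,e_k)$ with $t(e_i)=o(e_{i+1})$ for $1\le i<k$ and $o(e_1)=t(e_k)=x_0$; it has a backtracking if $e_{i+1}^{-1}=e_i$ for some $1\le i<k$, and it is reduced if neither $C$ nor $C^2$ ($C$ traversed twice) has a backtracking. Let $N^0_k$ be the number of reduced $x_0$-cycles of length $k$. An $x_0$-alternating cycle of length $k\ge 1$ is a sequence $[e_1,\dots,e_k]$ of arcs of $D_G$ for which there are vertices $x_0=v_0,v_1,\dots,v_k=x_0$ such that either $e_i=(v_{i-1},v_i)$ for $i$ odd and $e_i=(v_i,v_{i-1})$ for $i$ even, or $e_i=(v_i,v_{i-1})$ for $i$ odd and $e_i=(v_{i-1},v_i)$ for $i$ even, and such that $o(e_1)=o(e_k)=x_0$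 or $t(e_1)=t(e_k)=x_0$. It is reduced if $e_{i+1}\neq e_i$ for all $1\le i<k$ (no backtracking) and $e_k\ne e_1$ (no tail). Let $N^{0,a}_k$ be the number of reduced $x_0$-alternating cycles of length $k$. Define the generalized Ihara zeta function and the generalized alternating zeta function of $G$ by $$\zeta(G,t)=\exp\Big(\sum_{k\ge1}\frac{N^0_k}{k}t^k\Big),\qquad \zeta_a(G,t)=\exp\Big(\sum_{k\ge1}\frac{N^{0,a}_k}{k}t^k\Big).$$ Then $$\zeta_a(G,t)=\zeta(G,t)\,\zeta(G,-t),$$ both as an identity of formal power series in $t$ and as an identity of functions of $t\in\mathbb{C}$ with $q|t|<1$, where all the series in the exponents converge absolutely. -/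

import Mathlib

/-- A graph is vertex-transitive if any vertex can be mapped to any other by an automorphism. -/
def SimpleGraph.IsVertexTransitive {V : Type*} (G : SimpleGraph V) : Prop :=
  ∀ u v : V, ∃ φ : G ≃g G, φ u = v

/-- The symmetric digraph of a graph: every edge `uv` gives the two arcs `(u, v)` and `(v, u)`. -/
def SimpleGraph.symmDigraph {V : Type*} (G : SimpleGraph V) : Digraph V where
  Adj := G.Adj

namespace SimpleGraph

variable {V : Type*}

/-- A path of length `k`: a sequence of `k` arcs `(u, v)` of the graph, each starting where the
previous one ends. -/
def IsArcPath (G : SimpleGraph V) {k : ℕ} (e : Fin k → V × V) : Prop :=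
  (∀ i, G.Adj (e i).1 (e i).2) ∧
    ∀ (i : ℕ) (h : i + 1 < k), (e ⟨i, by omega⟩).2 = (e ⟨i + 1, h⟩).1

/-- An `x`-cycle: a path of positive length from `x` to `x`. -/
def IsArcCycle (G : SimpleGraph V) (x : V) {k : ℕ} (e : Fin k → V × V) : Prop :=
  G.IsArcPath e ∧ ∃ h : 0 < k, (e ⟨0, h⟩).1 = x ∧ (e ⟨k - 1, by omega⟩).2 = x

/-- Some arc of the sequence is followed by its inverse. -/
def HasArcBacktracking {k : ℕ} (e : Fin k → V × V) : Prop :=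
  ∃ (i : ℕ) (h : i + 1 < k), (e ⟨i + 1, h⟩).swap = e ⟨i, by omega⟩

/-- A cycle `C` is reduced if neither `C` nor `C²` has a backtracking. -/
def IsReducedArcCycle {k : ℕ} (e : Fin k → V × V) : Prop :=
  ¬ HasArcBacktracking e ∧ ¬ HasArcBacktracking (Fin.append e e)

/-- The number of reduced `x`-cycles of length `k`. -/
noncomputable def numReducedCycles (G : SimpleGraph V) (x : V) (k : ℕ) : ℕ :=
  {e : Fin k → V × V | G.IsArcCycle x e ∧ IsReducedArcCycle e}.ncard

end SimpleGraph

namespace Digraph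

variable {V : Type*}

/-- An alternating walk `(v₀, …, v_k) = [e₁, …, e_k]`. Here `e i` stands for `e_{i+1}`.
The first alternative is a walk `e₁ = (v₀, v₁), e₂ = (v₂, v₁), …` starting with an out-edge, the
second one a walk `e₁ = (v₁, v₀), e₂ = (v₁, v₂), …` starting with an in-edge. -/
def IsAltWalk (D : Digraph V) {k : ℕ} (v : Fin (k + 1) → V) (e : Fin k → V × V) : Prop :=
  (∀ i, D.Adj (e i).1 (e i).2) ∧
    ((∀ i : Fin k, e i =
        if Even (i : ℕ) then (v i.castSucc, v i.succ) else (v i.succ, v i.castSucc)) ∨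
     (∀ i : Fin k, e i =
        if Even (i : ℕ) then (v i.succ, v i.castSucc) else (v i.castSucc, v i.succ)))

/-- An `x`-alternating cycle: an alternating walk of positive length from `x` to `x` whose first
and last arcs both start at `x` or both end at `x`. -/
def IsAltCycle (D : Digraph V) (x : V) {k : ℕ} (e : Fin k → V × V) : Prop :=
  ∃ v : Fin (k + 1) → V, D.IsAltWalk v e ∧ v 0 = x ∧ v (Fin.last k) = x ∧
    ∃ h : 0 < k, ((e ⟨0, h⟩).1 = x ∧ (e ⟨k - 1, by omega⟩).1 = x) ∨
      ((e ⟨0, h⟩).2 = x ∧ (e ⟨k - 1, by omega⟩).2 = x)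

/-- An alternating walk has a backtracking if two consecutive arcs are equal. -/
def HasAltBacktracking {k : ℕ} (e : Fin k → V × V) : Prop :=
  ∃ (i : ℕ) (h : i + 1 < k), e ⟨i + 1, h⟩ = e ⟨i, by omega⟩

/-- An alternating cycle has a tail if its last arc equals its first arc. -/
def HasAltTail {k : ℕ} (e : Fin k → V × V) : Prop :=
  ∃ h : 0 < k, e ⟨k - 1, by omega⟩ = e ⟨0, h⟩

/-- The number of reduced `x`-alternating cycles of length `k`, that is, of those with neither a
backtracking nor a tail. -/
noncomputable def numReducedAltCycles (D : Digraph V) (x : V) (k : ℕ) : ℕ :=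
  {e : Fin k → V × V | D.IsAltCycle x e ∧ ¬ HasAltBacktracking e ∧ ¬ HasAltTail e}.ncard

end Digraph

/-- The `k`-th term (`k = 0, 1, …`) `N_{k+1} t^{k+1} / (k+1)` of the series `∑_{m ≥ 1} N_m t^m / m`. -/
noncomputable def zetaTerm (N : ℕ → ℕ) (t : ℂ) (k : ℕ) : ℂ :=
  (N (k + 1) : ℂ) / ((k : ℂ) + 1) * t ^ (k + 1)

/-- `exp (∑_{m ≥ 1} N_m t^m / m)` as a function of a complex variable. -/
noncomputable def expZeta (N : ℕ → ℕ) (t : ℂ) : ℂ :=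
  Complex.exp (∑' k : ℕ, zetaTerm N t k)

/-- `exp (∑_{m ≥ 1} N_m t^m / m)` as a formal power series. -/
noncomputable def expZetaSeries (N : ℕ → ℕ) : PowerSeries ℚ :=
  (PowerSeries.exp ℚ).subst
    (PowerSeries.mk fun m : ℕ => if m = 0 then (0 : ℚ) else (N m : ℚ) / (m : ℚ))

namespace SimpleGraph

variable {V : Type*}

/-- The generalized Ihara zeta function of `G` with base vertex `x₀`. -/
noncomputable def iharaZeta (G : SimpleGraph V) (x₀ : V) (t : ℂ) : ℂ :=
  expZeta (G.numReducedCycles x₀) t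

/-- The generalized Ihara zeta function of `G` as a formal power series. -/
noncomputable def iharaZetaSeries (G : SimpleGraph V) (x₀ : V) : PowerSeries ℚ :=
  expZetaSeries (G.numReducedCycles x₀)

/-- The generalized alternating zeta function of `G` with base vertex `x₀`. -/
noncomputable def altZeta (G : SimpleGraph V) (x₀ : V) (t : ℂ) : ℂ :=
  expZeta (G.symmDigraph.numReducedAltCycles x₀) t

/-- The generalized alternating zeta function of `G` as a formal power series. -/
noncomputable def altZetaSeries (G : SimpleGraph V) (x₀ : V) : PowerSeries ℚ :=
  expZetaSeries (G.symmDigraph.numReducedAltCycles x₀)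

end SimpleGraph

/-! Along an alternating walk the arcs are traversed alternately forwards and backwards, so
reversing every second arc gives an ordinary path. For even `k`, the first and last arcs then both
leave or both enter the base vertex. `flipOdd` and `flipEven` thus carry reduced cycles bijectively
onto two disjoint classes exhausting the reduced alternating cycles (`setOf_reducedAltCycles_eq`),
and the count doubles. For odd `k` the endpoint condition would force a loop, so the count is zero.
Since `1 + (-1)^k` is `2` or `0`, the alternating exponent is the Ihara exponent at `t` plus that at
`-t`. Exponentiating gives the identity; the bound `(q + 1) * q ^ k` on non-backtracking paths gives
finiteness and convergence. -/

namespace PowerSeries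

/-! ### Exponentials of formal power series -/

theorem constantCoeff_exp_subst {f : PowerSeries ℚ} (hf : constantCoeff f = 0) :
    constantCoeff ((exp ℚ).subst f) = 1 := by
  have h : (exp ℚ).subst f = 1 + (exp ℚ - 1).subst f := by
    have hs := HasSubst.of_constantCoeff_zero' hf
    conv_lhs => rw [← add_sub_cancel (1 : PowerSeries ℚ) (exp ℚ)]
    rw [subst_add hs, ← coe_substAlgHom hs, map_one]
  rw [h, map_add, map_one]
  have := constantCoeff_subst_eq_zero (a := f) hf (exp ℚ - 1) (by simp)
  rw [show constantCoeff ((exp ℚ - 1).subst f) = 0 from this, add_zero]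

theorem derivative_exp_subst {f : PowerSeries ℚ} (hf : constantCoeff f = 0) :
    derivative ℚ ((exp ℚ).subst f) = (exp ℚ).subst f * derivative ℚ f := by
  rw [derivative_subst (HasSubst.of_constantCoeff_zero' hf), derivative_exp]

/-- The logarithmic derivative of the product is the derivative of `f + g + h`, hence zero. Three
factors cover both uses in `exp_subst_add`: inverses (`h = 0`) and the triple `f + g, -f, -g`. -/
theorem exp_subst_mul_mul_eq_one {f g h : PowerSeries ℚ} (hf : constantCoeff f = 0)
    (hg : constantCoeff g = 0) (hh : constantCoeff h = 0) (hsum : f + g + h = 0) :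
    (exp ℚ).subst f * (exp ℚ).subst g * (exp ℚ).subst h = 1 := by
  apply derivative.ext
  · have hd : derivative ℚ f + derivative ℚ g + derivative ℚ h = 0 := by
      rw [← map_add, ← map_add, hsum, map_zero]
    simp only [Derivation.leibniz, derivative_exp_subst hf, derivative_exp_subst hg,
      derivative_exp_subst hh, smul_eq_mul, derivative_one]
    linear_combination ((exp ℚ).subst f * (exp ℚ).subst g * (exp ℚ).subst h) * hd
  · simp [constantCoeff_exp_subst hf, constantCoeff_exp_subst hg, constantCoeff_exp_subst hh]

theorem exp_subst_zero : (exp ℚ).subst (0 : PowerSeries ℚ) = (1 : PowerSeries ℚ) := by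
  rw [subst_zero_eq_C_constantCoeff]
  simp

theorem exp_subst_add {f g : PowerSeries ℚ} (hf : constantCoeff f = 0)
    (hg : constantCoeff g = 0) :
    (exp ℚ).subst (f + g) = (exp ℚ).subst f * (exp ℚ).subst g := by
  have hinv {a : PowerSeries ℚ} (ha : constantCoeff a = 0) :
      (exp ℚ).subst a * (exp ℚ).subst (-a) = 1 := by
    simpa [exp_subst_zero] using
      exp_subst_mul_mul_eq_one (h := 0) ha (g := -a) (by simp [ha]) (by simp) (by simp)
  have h := exp_subst_mul_mul_eq_one (f := f + g) (g := -f) (h := -g)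
    (by simp [hf, hg]) (by simp [hf]) (by simp [hg]) (by ring)
  linear_combination (exp ℚ).subst f * (exp ℚ).subst g * h
    - (exp ℚ).subst (f + g) * (exp ℚ).subst g * (exp ℚ).subst (-g) * hinv hf
    - (exp ℚ).subst (f + g) * hinv hg

theorem rescale_exp_subst (r : ℚ) {f : PowerSeries ℚ} (hf : constantCoeff f = 0) :
    rescale r ((exp ℚ).subst f) = (exp ℚ).subst (rescale r f) := by
  rw [rescale_eq_subst, rescale_eq_subst,
    subst_comp_subst_apply (HasSubst.of_constantCoeff_zero' hf) (HasSubst.smul_X' r)]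

theorem constantCoeff_rescale_apply (r : ℚ) (f : PowerSeries ℚ) :
    constantCoeff (rescale r f) = constantCoeff f := by
  rw [← coeff_zero_eq_constantCoeff_apply, coeff_rescale, pow_zero, one_mul,
    coeff_zero_eq_constantCoeff_apply]

end PowerSeries

/-! ### From counts to zeta functions -/

/-- If `M` vanishes at odd indices and is `2 * N` at positive even ones, the formal zeta series
factors. -/
theorem expZetaSeries_eq_mul_rescale {M N : ℕ → ℕ} (hodd : ∀ k, Odd k → M k = 0)
    (heven : ∀ k, 0 < k → Even k → M k = 2 * N k) :
    expZetaSeries M = expZetaSeries N * PowerSeries.rescale (-1 : ℚ) (expZetaSeries N) := by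
  unfold expZetaSeries
  rw [PowerSeries.rescale_exp_subst _ (by simp), ← PowerSeries.exp_subst_add (by simp)
    (by simp [PowerSeries.constantCoeff_rescale_apply])]
  congr 1
  ext k
  rcases Nat.eq_zero_or_pos k with rfl | hk
  · simp [PowerSeries.constantCoeff_rescale_apply]
  rcases Nat.even_or_odd k with h | h
  · simp [hk.ne', heven k hk h, h.neg_one_pow]
    ring
  · simp [hk.ne', hodd k h, h.neg_one_pow]

theorem zetaTerm_eq_add_neg {M N : ℕ → ℕ} (hodd : ∀ k, Odd k → M k = 0)
    (heven : ∀ k, 0 < k → Even k → M k = 2 * N k) (t : ℂ) (k : ℕ) :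
    zetaTerm M t k = zetaTerm N t k + zetaTerm N (-t) k := by
  unfold zetaTerm
  rcases Nat.even_or_odd (k + 1) with h | h
  · rw [heven _ k.succ_pos h, h.neg_pow]
    push_cast
    ring
  · rw [hodd _ h, h.neg_pow]
    push_cast
    ring

theorem summable_zetaTerm {N : ℕ → ℕ} {q : ℕ} (hN : ∀ k, N (k + 1) ≤ (q + 1) * q ^ k) {t : ℂ}
    (ht : (q : ℝ) * ‖t‖ < 1) : Summable (zetaTerm N t) := by
  refine Summable.of_norm_bounded (g := fun k => ((q : ℝ) + 1) * ‖t‖ * ((q : ℝ) * ‖t‖) ^ k)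
    ((summable_geometric_of_lt_one (by positivity) ht).mul_left _) fun k => ?_
  have h1 : (N (k + 1) : ℝ) ≤ ((q : ℝ) + 1) * (q : ℝ) ^ k := by exact_mod_cast hN k
  have h2 : ‖(k : ℂ) + 1‖ = (k : ℝ) + 1 := by
    exact_mod_cast Complex.norm_natCast (k + 1)
  rw [zetaTerm, norm_mul, norm_div, norm_pow, h2, Complex.norm_natCast]
  calc (N (k + 1) : ℝ) / ((k : ℝ) + 1) * ‖t‖ ^ (k + 1)
      ≤ (((q : ℝ) + 1) * (q : ℝ) ^ k) * ‖t‖ ^ (k + 1) := by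
        gcongr
        exact (div_le_self (by positivity) (by simp)).trans h1
    _ = _ := by ring

theorem expZeta_eq_mul_neg {M N : ℕ → ℕ} (hodd : ∀ k, Odd k → M k = 0)
    (heven : ∀ k, 0 < k → Even k → M k = 2 * N k) {t : ℂ} (h : Summable (zetaTerm N t))
    (h' : Summable (zetaTerm N (-t))) : expZeta M t = expZeta N t * expZeta N (-t) := by
  unfold expZeta
  rw [← Complex.exp_add, ← h.tsum_add h']
  simp only [zetaTerm_eq_add_neg hodd heven]


/-! ### Reduced cycles and their number -/

namespace SimpleGraph

variable {V : Type*}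

/-- The only new consecutive pair in the doubled cycle is the seam, where the last arc meets the
first. -/
theorem hasArcBacktracking_append_self_iff {k : ℕ} (e : Fin k → V × V) :
    HasArcBacktracking (Fin.append e e) ↔ HasArcBacktracking e ∨
      ∃ h : 0 < k, (e ⟨0, h⟩).swap = e ⟨k - 1, by omega⟩ := by
  have hl (i : ℕ) (h : i < k) : Fin.append e e ⟨i, by omega⟩ = e ⟨i, h⟩ :=
    Fin.append_left e e ⟨i, h⟩
  have hr (i : ℕ) (h : i < k) : Fin.append e e ⟨k + i, by omega⟩ = e ⟨i, h⟩ :=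
    Fin.append_right e e ⟨i, h⟩
  constructor
  · rintro ⟨i, h, hi⟩
    rcases lt_trichotomy (i + 1) k with hik | hik | hik
    · rw [hl _ hik, hl i (by omega)] at hi
      exact Or.inl ⟨i, hik, hi⟩
    · right
      obtain rfl : i = k - 1 := by omega
      refine ⟨by omega, ?_⟩
      rw [hl (k - 1) (by omega), ← hr 0 (by omega)] at *
      simpa only [hik, add_zero] using hi
    · obtain ⟨j, rfl⟩ := Nat.exists_eq_add_of_le (Nat.lt_succ_iff.mp hik)
      left
      refine ⟨j, by omega, ?_⟩
      rw [hr j (by omega)] at hi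
      simp only [add_assoc] at hi
      rwa [hr (j + 1) (by omega)] at hi
  · rintro (⟨i, h, hi⟩ | ⟨h, hi⟩)
    · refine ⟨i, by omega, ?_⟩
      rwa [hl _ h, hl i (by omega)]
    · refine ⟨k - 1, by omega, ?_⟩
      rw [hl (k - 1) (by omega), ← hi, ← hr 0 h]
      simp only [Nat.sub_add_cancel h, add_zero]

theorem isReducedArcCycle_iff {k : ℕ} (e : Fin k → V × V) :
    IsReducedArcCycle e ↔ ¬ HasArcBacktracking e ∧
      ¬ ∃ h : 0 < k, (e ⟨0, h⟩).swap = e ⟨k - 1, by omega⟩ := by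
  rw [IsReducedArcCycle, hasArcBacktracking_append_self_iff]
  tauto

/-- An arc cycle is the sequence of consecutive pairs of a closed sequence of vertices. -/
theorem isArcCycle_iff_exists_vertices (G : SimpleGraph V) (x : V) {k : ℕ} (e : Fin k → V × V) :
    G.IsArcCycle x e ↔ 0 < k ∧ (∀ i, G.Adj (e i).1 (e i).2) ∧ ∃ v : Fin (k + 1) → V,
      (∀ i : Fin k, e i = (v i.castSucc, v i.succ)) ∧ v 0 = x ∧ v (Fin.last k) = x := by
  constructor
  · rintro ⟨⟨hadj, hpath⟩, hk, h0, hlast⟩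
    -- The vertices are the sources of the arcs; the default `x` is the final vertex, at index `k`.
    refine ⟨hk, hadj, fun i => if h : (i : ℕ) < k then (e ⟨i, h⟩).1 else x, fun i => ?_, ?_, ?_⟩
    · ext
      · simp
      · by_cases h : (i : ℕ) + 1 < k
        · simpa [h] using hpath i h
        · have hi : i = ⟨k - 1, Nat.sub_lt hk one_pos⟩ := Fin.ext (Nat.eq_sub_of_add_eq (by omega))
          rw [← hi] at hlast
          simpa [h] using hlast
    · simpa [hk] using h0
    · simp
  · rintro ⟨hk, hadj, v, hv, h0, hlast⟩
    refine ⟨⟨hadj, fun i h => ?_⟩, hk, ?_, ?_⟩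
    · rw [hv, hv]
      rfl
    · rw [hv, ← h0]
      rfl
    · rw [hv, ← hlast]
      exact congrArg v (Fin.ext (Nat.sub_add_cancel hk))

/-- The sequences of `k + 1` arcs from `x` without backtracking are at most `(q + 1) * q ^ k`. -/
theorem exists_finset_nonbacktracking (G : SimpleGraph V) [G.LocallyFinite] {q : ℕ}
    (hreg : G.IsRegularOfDegree (q + 1)) (x : V) (k : ℕ) :
    ∃ T : Finset (Fin (k + 1) → V × V), T.card ≤ (q + 1) * q ^ k ∧
      ∀ e : Fin (k + 1) → V × V, G.IsArcPath e → (e 0).1 = x → ¬ HasArcBacktracking e →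
        e ∈ T := by
  classical
  induction k with
  | zero =>
    refine ⟨(G.neighborFinset x).image fun w _ => (x, w), ?_, fun e he hx _ => ?_⟩
    · simpa using (Finset.card_image_le.trans (hreg x).le)
    · rw [Finset.mem_image]
      refine ⟨(e 0).2, by simpa [hx] using he.1 0, funext fun i => ?_⟩
      obtain rfl : i = 0 := Fin.ext (by omega)
      exact Prod.ext hx.symm rfl
  | succ k ih =>
    obtain ⟨T, hcard, hT⟩ := ih
    -- `T` may contain sequences that are not paths. The filter makes the erased vertex a genuine
    -- neighbour, leaving exactly `q` continuations.
    refine ⟨(T.filter fun e => G.Adj (e (Fin.last k)).1 (e (Fin.last k)).2).biUnion fun e =>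
      ((G.neighborFinset (e (Fin.last k)).2).erase (e (Fin.last k)).1).image fun w =>
        (Fin.snoc e ((e (Fin.last k)).2, w) : Fin (k + 2) → V × V), ?_, fun e he hx hb => ?_⟩
    · rw [pow_succ, ← mul_assoc]
      refine (Finset.card_biUnion_le_card_mul _ _ q fun e he => ?_).trans
        (Nat.mul_le_mul_right q ((Finset.card_filter_le _ _).trans hcard))
      refine Finset.card_image_le.trans ?_
      rw [Finset.card_erase_of_mem (by simpa using ((Finset.mem_filter.1 he).2).symm),
        card_neighborFinset_eq_degree, hreg, Nat.add_sub_cancel]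
    · have hlast : (e (Fin.last k).castSucc).2 = (e (Fin.last (k + 1))).1 :=
        he.2 k (by omega)
      simp only [Finset.mem_biUnion, Finset.mem_filter, Finset.mem_image, Finset.mem_erase,
        mem_neighborFinset]
      refine ⟨Fin.init e, ⟨hT _ ⟨fun i => he.1 _, fun i h => he.2 i (by omega)⟩ hx ?_, he.1 _⟩,
        (e (Fin.last (k + 1))).2, ⟨?_, ?_⟩, ?_⟩
      · rintro ⟨i, h, hi⟩
        exact hb ⟨i, by omega, hi⟩
      · intro h
        exact hb ⟨k, by omega, Prod.ext h hlast.symm⟩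
      · have := he.1 (Fin.last (k + 1))
        rwa [← hlast] at this
      · conv_rhs => rw [← Fin.snoc_init_self e]
        congr 1
        exact Prod.ext hlast rfl

theorem exists_finset_reducedCycles (G : SimpleGraph V) [G.LocallyFinite] {q : ℕ}
    (hreg : G.IsRegularOfDegree (q + 1)) (x : V) (k : ℕ) :
    ∃ T : Finset (Fin (k + 1) → V × V), T.card ≤ (q + 1) * q ^ k ∧
      {e : Fin (k + 1) → V × V | G.IsArcCycle x e ∧ IsReducedArcCycle e} ⊆ T := by
  obtain ⟨T, hcard, hT⟩ := G.exists_finset_nonbacktracking hreg x k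
  exact ⟨T, hcard, fun e he => hT e he.1.1 he.1.2.2.1 he.2.1⟩

theorem numReducedCycles_succ_le (G : SimpleGraph V) [G.LocallyFinite] {q : ℕ}
    (hreg : G.IsRegularOfDegree (q + 1)) (x : V) (k : ℕ) :
    G.numReducedCycles x (k + 1) ≤ (q + 1) * q ^ k := by
  obtain ⟨T, hcard, hT⟩ := G.exists_finset_reducedCycles hreg x k
  refine (Set.ncard_le_ncard hT T.finite_toSet).trans ?_
  rwa [Set.ncard_coe_finset]

theorem finite_reducedCycles (G : SimpleGraph V) [G.LocallyFinite] {q : ℕ}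
    (hreg : G.IsRegularOfDegree (q + 1)) (x : V) {k : ℕ} (hk : 0 < k) :
    {e : Fin k → V × V | G.IsArcCycle x e ∧ IsReducedArcCycle e}.Finite := by
  obtain ⟨k, rfl⟩ := Nat.exists_eq_succ_of_ne_zero hk.ne'
  obtain ⟨T, -, hT⟩ := G.exists_finset_reducedCycles hreg x k
  exact T.finite_toSet.subset hT

/-! ### Alternating cycles as flipped cycles -/

/-- Reverse every second arc of a sequence, starting with the second one. -/
def flipOdd {k : ℕ} (e : Fin k → V × V) : Fin k → V × V :=
  fun i => if Even (i : ℕ) then e i else (e i).swap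

/-- Reverse every second arc of a sequence, starting with the first one. -/
def flipEven {k : ℕ} (e : Fin k → V × V) : Fin k → V × V :=
  fun i => if Even (i : ℕ) then (e i).swap else e i

theorem flipOdd_involutive {k : ℕ} :
    Function.Involutive (flipOdd : (Fin k → V × V) → Fin k → V × V) := by
  intro e
  funext i
  by_cases h : Even (i : ℕ) <;> simp [flipOdd, h]

theorem flipEven_involutive {k : ℕ} :
    Function.Involutive (flipEven : (Fin k → V × V) → Fin k → V × V) := by
  intro e
  funext i
  by_cases h : Even (i : ℕ) <;> simp [flipEven, h]

/-- Exactly one of two consecutive arcs is reversed, which turns "inverse" into "equal". -/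
theorem hasAltBacktracking_flipOdd {k : ℕ} (e : Fin k → V × V) :
    Digraph.HasAltBacktracking (flipOdd e) ↔ HasArcBacktracking e := by
  refine exists_congr fun i => exists_congr fun h => ?_
  by_cases hi : Even i <;> simp [flipOdd, hi, Nat.even_add_one]
  rw [← Prod.swap_inj, Prod.swap_swap]

theorem hasAltBacktracking_flipEven {k : ℕ} (e : Fin k → V × V) :
    Digraph.HasAltBacktracking (flipEven e) ↔ HasArcBacktracking e := by
  refine exists_congr fun i => exists_congr fun h => ?_
  by_cases hi : Even i <;> simp [flipEven, hi, Nat.even_add_one]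
  rw [← Prod.swap_inj, Prod.swap_swap]

/-- For even `k` the indices `0` and `k - 1` have opposite parity, so a backtracking at the seam
becomes a tail. -/
theorem hasAltTail_flipOdd {k : ℕ} (hk : Even k) (e : Fin k → V × V) :
    Digraph.HasAltTail (flipOdd e) ↔ ∃ h : 0 < k, (e ⟨0, h⟩).swap = e ⟨k - 1, by omega⟩ := by
  refine exists_congr fun h => ?_
  have hodd : ¬ Even (k - 1) := by grind
  simp only [flipOdd, hodd, Even.zero, if_true, if_false]
  rw [← Prod.swap_inj, Prod.swap_swap, eq_comm]

theorem hasAltTail_flipEven {k : ℕ} (hk : Even k) (e : Fin k → V × V) :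
    Digraph.HasAltTail (flipEven e) ↔ ∃ h : 0 < k, (e ⟨0, h⟩).swap = e ⟨k - 1, by omega⟩ := by
  refine exists_congr fun h => ?_
  have hodd : ¬ Even (k - 1) := by grind
  simp only [flipEven, hodd, Even.zero, if_true, if_false]
  rw [eq_comm]

/-- For odd `k` the first and last arcs have the same direction along the walk: one leaves `x` and
the other enters it. Sharing the source or the target `x` would make one of them a loop. -/
theorem not_isAltCycle_of_odd (G : SimpleGraph V) (x : V) {k : ℕ} (hk : Odd k)
    (e : Fin k → V × V) : ¬ G.symmDigraph.IsAltCycle x e := by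
  rintro ⟨v, ⟨hadj, hv⟩, h0, hlast, h, hends⟩
  have heven : Even (k - 1) := by grind
  have hfirst : v (Fin.castSucc ⟨0, h⟩) = x := h0
  have hend : v (Fin.succ ⟨k - 1, by omega⟩) = x := by
    rw [← hlast]
    exact congrArg v (Fin.ext (Nat.sub_add_cancel h))
  have ha : G.Adj (e ⟨0, h⟩).1 (e ⟨0, h⟩).2 := hadj _
  have hb : G.Adj (e ⟨k - 1, by omega⟩).1 (e ⟨k - 1, by omega⟩).2 := hadj _
  have hne := ha.ne
  have hne' := hb.ne
  rcases hv with hv | hv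
  all_goals
    simp only [hv, heven, Even.zero, if_true, hfirst, hend] at hends hne hne'
    grind

theorem isAltCycle_iff (G : SimpleGraph V) (x : V) {k : ℕ} (hk : Even k) (e : Fin k → V × V) :
    G.symmDigraph.IsAltCycle x e ↔
      G.IsArcCycle x (flipOdd e) ∨ G.IsArcCycle x (flipEven e) := by
  have hodd (h : 0 < k) : ¬ Even (k - 1) := by grind
  have hadj_odd : (∀ i, G.Adj (flipOdd e i).1 (flipOdd e i).2) ↔ ∀ i, G.Adj (e i).1 (e i).2 := by
    refine forall_congr' fun i => ?_
    by_cases h : Even (i : ℕ) <;> simp [flipOdd, h, G.adj_comm]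
  have hadj_even :
      (∀ i, G.Adj (flipEven e i).1 (flipEven e i).2) ↔ ∀ i, G.Adj (e i).1 (e i).2 := by
    refine forall_congr' fun i => ?_
    by_cases h : Even (i : ℕ) <;> simp [flipEven, h, G.adj_comm]
  have hv_odd (v : Fin (k + 1) → V) : (∀ i, flipOdd e i = (v i.castSucc, v i.succ)) ↔
      ∀ i : Fin k, e i =
        if Even (i : ℕ) then (v i.castSucc, v i.succ) else (v i.succ, v i.castSucc) := by
    refine forall_congr' fun i => ?_
    by_cases h : Even (i : ℕ) <;> simp [flipOdd, h, Prod.ext_iff, and_comm]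
  have hv_even (v : Fin (k + 1) → V) : (∀ i, flipEven e i = (v i.castSucc, v i.succ)) ↔
      ∀ i : Fin k, e i =
        if Even (i : ℕ) then (v i.succ, v i.castSucc) else (v i.castSucc, v i.succ) := by
    refine forall_congr' fun i => ?_
    by_cases h : Even (i : ℕ) <;> simp [flipEven, h, Prod.ext_iff, and_comm]
  rw [isArcCycle_iff_exists_vertices, isArcCycle_iff_exists_vertices]
  simp only [hadj_odd, hadj_even, hv_odd, hv_even]
  constructor
  · rintro ⟨v, ⟨hadj, hv | hv⟩, h0, hlast, h, -⟩
    · exact Or.inl ⟨h, hadj, v, hv, h0, hlast⟩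
    · exact Or.inr ⟨h, hadj, v, hv, h0, hlast⟩
  -- By parity of `k`, the last arc has `x` at the same end as the first, so the endpoint condition
  -- is automatic.
  · have hend (h : 0 < k) (v : Fin (k + 1) → V) (hlast : v (Fin.last k) = x) :
        v (Fin.succ ⟨k - 1, by omega⟩) = x := by
      rw [← hlast]
      exact congrArg v (Fin.ext (Nat.sub_add_cancel h))
    rintro (⟨h, hadj, v, hv, h0, hlast⟩ | ⟨h, hadj, v, hv, h0, hlast⟩)
    · refine ⟨v, ⟨hadj, Or.inl hv⟩, h0, hlast, h, Or.inl ⟨?_, ?_⟩⟩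
      · simpa [hv] using h0
      · simpa only [hv, hodd h, if_false] using hend h v hlast
    · refine ⟨v, ⟨hadj, Or.inr hv⟩, h0, hlast, h, Or.inr ⟨?_, ?_⟩⟩
      · simpa [hv] using h0
      · simpa only [hv, hodd h, if_false] using hend h v hlast

theorem numReducedAltCycles_of_odd (G : SimpleGraph V) (x : V) {k : ℕ} (hk : Odd k) :
    G.symmDigraph.numReducedAltCycles x k = 0 := by
  simp [Digraph.numReducedAltCycles, G.not_isAltCycle_of_odd x hk]

theorem setOf_reducedAltCycles_eq (G : SimpleGraph V) (x : V) {k : ℕ} (hk : Even k) :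
    {e : Fin k → V × V | G.symmDigraph.IsAltCycle x e ∧ ¬ Digraph.HasAltBacktracking e ∧
      ¬ Digraph.HasAltTail e} =
      flipOdd '' {e : Fin k → V × V | G.IsArcCycle x e ∧ IsReducedArcCycle e} ∪
        flipEven '' {e : Fin k → V × V | G.IsArcCycle x e ∧ IsReducedArcCycle e} := by
  rw [flipOdd_involutive.image_eq_preimage_symm, flipEven_involutive.image_eq_preimage_symm]
  ext e
  have hodd : IsReducedArcCycle (flipOdd e) ↔
      ¬ Digraph.HasAltBacktracking e ∧ ¬ Digraph.HasAltTail e := by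
    rw [isReducedArcCycle_iff, ← hasAltBacktracking_flipOdd, ← hasAltTail_flipOdd hk,
      flipOdd_involutive e]
  have heven : IsReducedArcCycle (flipEven e) ↔
      ¬ Digraph.HasAltBacktracking e ∧ ¬ Digraph.HasAltTail e := by
    rw [isReducedArcCycle_iff, ← hasAltBacktracking_flipEven, ← hasAltTail_flipEven hk,
      flipEven_involutive e]
  simp only [Set.mem_ofPred_eq, Set.mem_union, Set.mem_preimage, G.isAltCycle_iff x hk, hodd, heven]
  tauto

theorem numReducedAltCycles_of_even (G : SimpleGraph V) [G.LocallyFinite] {q : ℕ}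
    (hreg : G.IsRegularOfDegree (q + 1)) (x : V) {k : ℕ} (hpos : 0 < k) (hk : Even k) :
    G.symmDigraph.numReducedAltCycles x k = 2 * G.numReducedCycles x k := by
  have hfin := G.finite_reducedCycles hreg x hpos
  rw [Digraph.numReducedAltCycles, G.setOf_reducedAltCycles_eq x hk,
    Set.ncard_union_eq _ (hfin.image _) (hfin.image _),
    Set.ncard_image_of_injective _ flipOdd_involutive.injective,
    Set.ncard_image_of_injective _ flipEven_involutive.injective, ← two_mul, numReducedCycles]
  -- The first arc leaves `x` in one image and enters `x` in the other; a common element would start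
  -- with a loop.
  rw [Set.disjoint_left]
  rintro _ ⟨e, ⟨⟨⟨hadj, -⟩, h, he, -⟩, -⟩, rfl⟩ ⟨f, ⟨⟨-, h', hf, -⟩, -⟩, hfe⟩
  have h0 := congrFun hfe ⟨0, h⟩
  simp only [flipOdd, flipEven, Even.zero, if_true] at h0
  refine (hadj ⟨0, h⟩).ne ?_
  rw [he, ← h0, Prod.snd_swap, hf]

end SimpleGraph

/-- The identity `ζ_a(G, t) = ζ(G, t) ζ(G, -t)`, first between formal power series, then between
functions on the disc `q |t| < 1`, where all the defining series converge. -/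
theorem proposition3 {V : Type*} (G : SimpleGraph V) [G.LocallyFinite] (q : ℕ)
    (hconn : G.Connected) (htrans : G.IsVertexTransitive)
    (hreg : G.IsRegularOfDegree (q + 1)) (x₀ : V) :
    G.altZetaSeries x₀ =
        G.iharaZetaSeries x₀ * PowerSeries.rescale (-1 : ℚ) (G.iharaZetaSeries x₀) ∧
      ∀ t : ℂ, (q : ℝ) * ‖t‖ < 1 →
        Summable (zetaTerm (G.symmDigraph.numReducedAltCycles x₀) t) ∧
        Summable (zetaTerm (G.numReducedCycles x₀) t) ∧
        Summable (zetaTerm (G.numReducedCycles x₀) (-t)) ∧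
        G.altZeta x₀ t = G.iharaZeta x₀ t * G.iharaZeta x₀ (-t) := by
  have hodd (k : ℕ) (hk : Odd k) := G.numReducedAltCycles_of_odd x₀ hk
  have heven (k : ℕ) (hpos : 0 < k) (hk : Even k) :=
    G.numReducedAltCycles_of_even hreg x₀ hpos hk
  refine ⟨expZetaSeries_eq_mul_rescale hodd heven, fun t ht => ?_⟩
  have hs := summable_zetaTerm (G.numReducedCycles_succ_le hreg x₀) ht
  have hs' := summable_zetaTerm (t := -t) (G.numReducedCycles_succ_le hreg x₀)
    (by rwa [norm_neg])
  -- The alternating series converges as a termwise sum of the two Ihara series.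
  exact ⟨(hs.add hs').congr fun k => (zetaTerm_eq_add_neg hodd heven t k).symm, hs, hs',
    expZeta_eq_mul_neg hodd heven hs hs'⟩
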